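/- **Setting.** Let $G$ be a group. An $\mathbb R$-tree is a non-empty metric space in which any two points are joined by a unique arc and every arc is isometric to a closed interval. A point $p$ of it is *regular* if $T\setminus\{p\}$ has exactly two components; a *metric simplicial tree* is an $\mathbb R$-tree whose non-regular points have no accumulation point. A *$G$-tree* is a metric simplicial tree $T$ with an isometric action of $G$. Its vertex set $V(T)$ consists of the non-regular points and of the midpoints of those arcs between two non-regular points, with no further non-regular point on them, whose endpoints are interchanged by an element of $G$; if all points of $T$ are regular (so that this rule gives no vertices, and $T$ is a line), $V(T)$ is any chosen non-empty $G$-invariant set without accumulation points for which no edge has its endpoints interchanged by an element of $G$. The *edges* are the arcs joining two vertices and containing no other vertex. A *subtree* is a connected non-empty union of a set of edges and a set of vertices that includes the endpoints of these edges. The $G$-tree $T$ is *minimal* if it has no proper $G$-invariant subtree, *cocompact* if $T/G$ is compact, and *edge-free* if every edge has trivial setwise stabiliser. A subgroup of $G$ is *elliptic* if it fixes a point of $T$. For a set $\mathcal G$ of subgroups of $G$, $\mathcal O(G,\mathcal G)$ consists of the minimal, cocompact, edge-free $G$-trees whose set of elliptic subgroups is $\mathcal G$. Let $\alpha$ be an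 automorphism of $G$ with $\{\alpha(H): H\in\mathcal G\}=\mathcal G$ (so $\alpha$ represents an element of $\mathrm{Out}(G,\mathcal G)$), and for $T\in\mathcal O(G,\mathcal G)$ let $\alpha T$ be the same metric tree on which $g\in G$ acts as $\alpha(g)$ acts on $T$. A map $f:T\to\alpha T$ *topologically represents* $\alpha$ if it is $G$-equivariant, Lipschitz, and straight: for every edge $e$ of $T$ there is $\lambda_e\ge 0$ with $d(f(a),f(b))=\lambda_e\,d(a,b)$ for all $a,b\in e$. Let $\mathrm{Lip}(f)$ be the least Lipschitz constant of $f$. **Proposition.** Let $T\in\mathcal O(G,\mathcal G)$ have more than one point, let $\alpha$ represent an element of $\mathrm{Out}(G,\mathcal G)$, and let $f:T\to\alpha T$ topologically represent $\alpha$. Then $\mathrm{Lip}(f)=1$ if and only if $f$ is an isometry (that is, distance-preserving and bijective). -/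

import Mathlib

open scoped Pointwise NNReal

namespace OuterSpace

section Trees

variable {T : Type*} [MetricSpace T]

/-- `A` is a (non-degenerate) arc with endpoints `x` and `y`: the image of an injective path. The
unit interval is compact, so an injective path is a homeomorphism onto its image. -/
def IsArc (A : Set T) (x y : T) : Prop :=
  ∃ γ : unitInterval → T, Continuous γ ∧ Function.Injective γ ∧ γ 0 = x ∧ γ 1 = y ∧
    Set.range γ = A

variable (T) in
/-- `ℝ`-trees: non-empty metric spaces in which any two points are joined by a unique arc, and in
which every arc is isometric to a closed interval of the real line. -/
structure IsRTree : Prop where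
  nonempty : Nonempty T
  existsUnique_arc : ∀ x y : T, x ≠ y → ∃! A : Set T, IsArc A x y
  arc_isometric : ∀ (A : Set T) (x y : T), IsArc A x y →
    ∃ a b : ℝ, a ≤ b ∧ Nonempty (A ≃ᵢ Set.Icc a b)

/-- A point is regular if its complement has exactly two components. -/
def IsRegularPoint (p : T) : Prop :=
  ENat.card (ConnectedComponents ↥({p}ᶜ : Set T)) = 2

variable (T) in
/-- The set of branch points and external points. -/
def nonRegularPoints : Set T := {p | ¬ IsRegularPoint p}

/-- `S` is a discrete subset of the whole space, that is, it has no accumulation point (closed and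
discrete). -/
def IsDiscreteIn (S : Set T) : Prop :=
  ∀ p : T, ∃ ε : ℝ, 0 < ε ∧ ∀ q ∈ S, q ≠ p → ε ≤ dist p q

variable (T) in
/-- Metric simplicial trees. -/
structure IsMetricSimplicialTree : Prop where
  isRTree : IsRTree T
  discrete : IsDiscreteIn (nonRegularPoints T)

/-- `e` is an edge with endpoints `u` and `v` for the vertex set `V`: an arc between these two
vertices that contains no other vertex. -/
def IsEdgeBetween (V : Set T) (e : Set T) (u v : T) : Prop :=
  u ∈ V ∧ v ∈ V ∧ IsArc e u v ∧ e ∩ V = {u, v}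

/-- The edge set determined by the vertex set `V`. -/
def edgeSet (V : Set T) : Set (Set T) := {e | ∃ u v, IsEdgeBetween V e u v}

/-- A subforest: the union of a set of vertices and a set of edges, where the endpoints of the
chosen edges are among the chosen vertices. -/
def IsSubforest (V : Set T) (A : Set T) : Prop :=
  ∃ V' ⊆ V, ∃ E' ⊆ edgeSet V, (∀ e ∈ E', e ∩ V ⊆ V') ∧ A = V' ∪ ⋃₀ E'

/-- A subtree is a connected (in particular non-empty) subforest. -/
def IsSubtree (V : Set T) (A : Set T) : Prop := IsSubforest V A ∧ IsConnected A

end Trees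

section Actions

variable (G : Type*) [Group G] {T : Type*} [MetricSpace T] [MulAction G T]

/-- The midpoints of those edges of the coarsest structure (the one whose vertices are the
non-regular points) whose endpoints are interchanged by an element of `G`. -/
def invertedMidpoints : Set T :=
  {m | ∃ (e : Set T) (u v : T) (g : G), IsEdgeBetween (nonRegularPoints T) e u v ∧
    g • u = v ∧ g • v = u ∧ m ∈ e ∧ dist m u = dist m v}

/-- `V` is the vertex set of the `G`-tree `T`: the non-regular points together with the midpoints of
the inverted edges. If every point of `T` is regular (so that `T` is a line and the rule would give
no vertices at all), `V` may be any non-empty discrete `G`-invariant set for which no edge is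
inverted. -/
structure IsVertexSet (V : Set T) : Prop where
  eq_of_nonRegular : (nonRegularPoints T).Nonempty →
    V = nonRegularPoints T ∪ invertedMidpoints G
  of_line : nonRegularPoints T = ∅ →
    V.Nonempty ∧ IsDiscreteIn V ∧ (∀ g : G, g • V = V) ∧
      ∀ (e : Set T) (u v : T) (g : G), IsEdgeBetween V e u v → ¬ (g • u = v ∧ g • v = u)

/-- There is no proper `G`-invariant subtree. -/
def IsMinimalAction (V : Set T) : Prop :=
  ∀ A : Set T, IsSubtree V A → (∀ g : G, g • A = A) → A = Set.univ

/-- Every edge has trivial (setwise) stabiliser. -/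
def IsEdgeFree (V : Set T) : Prop :=
  ∀ e ∈ edgeSet V, MulAction.stabilizer G e = ⊥

variable (T) in
/-- The quotient `T / G` is compact. -/
def IsCocompact : Prop := CompactSpace (Quotient (MulAction.orbitRel G T))

variable (T) in
/-- The set of elliptic subgroups: those that fix a point of `T`. -/
def ellipticSubgroups : Set (Subgroup G) := {H | ∃ x : T, ∀ h ∈ H, h • x = x}

variable {G}

variable (T) in
/-- The `G`-tree `T`, with vertex set `V`, represents a point of the deformation space
`𝒪(G, 𝒢)`: it is a minimal, cocompact, edge-free `G`-tree whose set of elliptic subgroups is `𝒢`. -/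
structure MemDeformationSpace (𝒢 : Set (Subgroup G)) (V : Set T) : Prop where
  tree : IsMetricSimplicialTree T
  isometric : ∀ (g : G) (x y : T), dist (g • x) (g • y) = dist x y
  vertexSet : IsVertexSet G V
  minimal : IsMinimalAction G V
  cocompact : IsCocompact G T
  edgeFree : IsEdgeFree G V
  elliptic : ellipticSubgroups G T = 𝒢

end Actions

/-- The automorphism `α` leaves the set `𝒢` of subgroups invariant, so it represents an element of
`Out(G, 𝒢)`. -/
def PreservesSystem {G : Type*} [Group G] (α : MulAut G) (𝒢 : Set (Subgroup G)) : Prop :=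
  (fun H : Subgroup G => H.map α.toMonoidHom) '' 𝒢 = 𝒢

/-- The twisted tree `αT`: the metric space `T`, on which `g` acts as `α g` acts on `T`. -/
def Twist {G : Type*} [Group G] (_α : MulAut G) (T : Type*) : Type _ := T

instance {G : Type*} [Group G] (α : MulAut G) (T : Type*) [MetricSpace T] :
    MetricSpace (Twist α T) := inferInstanceAs (MetricSpace T)

instance {G : Type*} [Group G] (α : MulAut G) (T : Type*) [MulAction G T] :
    MulAction G (Twist α T) := MulAction.compHom T α.toMonoidHom

section Maps

variable (G : Type*) [Group G] {T S : Type*} [MetricSpace T] [MetricSpace S]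
  [MulAction G T] [MulAction G S]

/-- `𝒪`-maps: `G`-equivariant Lipschitz continuous maps. -/
def IsOMap (f : T → S) : Prop :=
  (∀ (g : G) (x : T), f (g • x) = g • f x) ∧ ∃ K : ℝ≥0, LipschitzWith K f

/-- `f` has constant speed on every edge of `T`. -/
def IsStraight (V : Set T) (f : T → S) : Prop :=
  ∀ e ∈ edgeSet V, ∃ l : ℝ, 0 ≤ l ∧ ∀ a ∈ e, ∀ b ∈ e, dist (f a) (f b) = l * dist a b

/-- The Lipschitz constant `Lip(f)`: the least Lipschitz constant of a Lipschitz map. -/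
noncomputable def lip (f : T → S) : ℝ≥0 := sInf {K : ℝ≥0 | LipschitzWith K f}

end Maps

/-- `f : T → αT` topologically represents `α`: it is a straight `𝒪`-map. -/
def TopologicallyRepresents {G : Type*} [Group G] {T : Type*} [MetricSpace T] [MulAction G T]
    (V : Set T) (α : MulAut G) (f : T → Twist α T) : Prop :=
  IsOMap G f ∧ IsStraight V f

end OuterSpace

/-! The orbit distance, the infimum over g of d(x, g y), turns T/G into a compact pseudometric
space. Minimality makes the equivariant map f onto (`surjective_of_equivariant`), so if f is
1-Lipschitz it induces a distance-non-increasing surjection of T/G onto itself. Such a self-map of a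
compact pseudometric space preserves all distances (`IsCocompact.orbitDist_le_map`).

This descends to information on T because edge stabilisers are trivial: off the vertices, the orbit
distance agrees locally with d (`exists_dist_le_dist_smul`). Hence f has speed 1 on each edge
(`dist_map_of_mem_edge`), and f x = f y forces x = y when neither x nor f x is a vertex
(`eq_of_map_eq`). A fold of f would identify infinitely many pairs of points, only finitely many of
which involve vertices, so f preserves betweenness (`map_mem_seg`). Lengths then add up along
geodesics and f is an isometry. Conversely, an isometry of a space with two points has Lipschitz
constant 1. -/

namespace OuterSpace

open Set

/-! ### Geodesics, medians and separation in ℝ-trees -/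

section RTree

variable {T : Type*} [MetricSpace T]

/-- The metric segment between two points. -/
def seg (x y : T) : Set T := {z | dist x z + dist z y = dist x y}

theorem mem_seg {x y z : T} : z ∈ seg x y ↔ dist x z + dist z y = dist x y := Iff.rfl

theorem left_mem_seg (x y : T) : x ∈ seg x y := by simp [mem_seg]

theorem right_mem_seg (x y : T) : y ∈ seg x y := by simp [mem_seg]

theorem seg_comm (x y : T) : seg x y = seg y x := by
  ext z
  rw [mem_seg, mem_seg, dist_comm x z, dist_comm z y, dist_comm x y, add_comm]

theorem dist_le_of_mem_seg {x y z : T} (h : z ∈ seg x y) : dist x z ≤ dist x y := by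
  have := mem_seg.1 h
  have := dist_nonneg (x := z) (y := y)
  linarith

theorem seg_subset_left {x y p : T} (hp : p ∈ seg x y) : seg x p ⊆ seg x y := by
  intro z hz
  rw [mem_seg] at *
  have := dist_triangle z p y
  have := dist_triangle x z y
  linarith

theorem seg_subset_right {x y p : T} (hp : p ∈ seg x y) : seg p y ⊆ seg x y := by
  rw [seg_comm p y, seg_comm x y]
  exact seg_subset_left (by rwa [seg_comm])

/-- If `p` is on `[x, y]` and `q` is on `[x, p]`, then `p` is on `[q, y]`. -/
theorem mem_seg_of_mem_seg_left {x y p q : T} (hp : p ∈ seg x y) (hq : q ∈ seg x p) :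
    p ∈ seg q y := by
  rw [mem_seg] at *
  have := dist_triangle q p y
  have := dist_triangle x q y
  linarith

theorem seg_inter_subset_of_mem {x y p : T} (hp : p ∈ seg x y) : seg x p ∩ seg p y ⊆ {p} := by
  rintro w ⟨h1, h2⟩
  rw [mem_seg] at *
  have := dist_triangle x w y
  rw [dist_comm p w] at h2
  have h0 : dist w p ≤ 0 := by linarith
  exact dist_le_zero.1 h0

/-- `φ` parametrizes a geodesic from `x` to `y` by arc length. -/
structure IsGeodesic (φ : ℝ → T) (x y : T) : Prop where
  continuous : Continuous φ
  left : φ 0 = x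
  right : φ (dist x y) = y
  dist_eq : ∀ s ∈ Icc 0 (dist x y), ∀ t ∈ Icc 0 (dist x y), dist (φ s) (φ t) = |s - t|

namespace IsGeodesic

variable {φ : ℝ → T} {x y : T}

theorem dist_left (h : IsGeodesic φ x y) {t : ℝ} (ht : t ∈ Icc 0 (dist x y)) :
    dist x (φ t) = t := by
  have := h.dist_eq 0 ⟨le_rfl, dist_nonneg⟩ t ht
  rw [h.left] at this
  rw [this, zero_sub, abs_neg, abs_of_nonneg ht.1]

theorem dist_right (h : IsGeodesic φ x y) {t : ℝ} (ht : t ∈ Icc 0 (dist x y)) :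
    dist (φ t) y = dist x y - t := by
  have := h.dist_eq t ht (dist x y) ⟨dist_nonneg, le_rfl⟩
  rw [h.right] at this
  rw [this, abs_sub_comm, abs_of_nonneg (sub_nonneg.2 ht.2)]

theorem mem_seg (h : IsGeodesic φ x y) {t : ℝ} (ht : t ∈ Icc 0 (dist x y)) :
    φ t ∈ seg x y := by
  rw [OuterSpace.mem_seg, h.dist_left ht, h.dist_right ht]
  ring

theorem injOn (h : IsGeodesic φ x y) : InjOn φ (Icc 0 (dist x y)) := by
  intro s hs t ht hst
  have := h.dist_eq s hs t ht
  rw [hst, dist_self, eq_comm, abs_eq_zero] at this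
  linarith

end IsGeodesic

theorem IsArc.ne {A : Set T} {x y : T} (h : IsArc A x y) : x ≠ y := by
  obtain ⟨γ, -, hi, h0, h1, -⟩ := h
  rintro rfl
  exact zero_ne_one (hi (h0.trans h1.symm))

theorem IsArc.left_mem {A : Set T} {x y : T} (h : IsArc A x y) : x ∈ A := by
  obtain ⟨γ, -, hi, h0, h1, rfl⟩ := h
  exact ⟨0, h0⟩

theorem IsArc.right_mem {A : Set T} {x y : T} (h : IsArc A x y) : y ∈ A := by
  obtain ⟨γ, -, hi, h0, h1, rfl⟩ := h
  exact ⟨1, h1⟩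

theorem isArc_image {L : ℝ} (hL : 0 < L) {φ : ℝ → T} (hc : Continuous φ)
    (hi : InjOn φ (Icc 0 L)) : IsArc (φ '' Icc 0 L) (φ 0) (φ L) := by
  have hm : ∀ t : unitInterval, L * (t : ℝ) ∈ Icc 0 L := fun t =>
    ⟨mul_nonneg hL.le t.2.1, mul_le_of_le_one_right hL.le t.2.2⟩
  refine ⟨fun t => φ (L * t), by fun_prop, ?_, by simp, by simp, ?_⟩
  · intro s t hst
    exact Subtype.ext (mul_left_cancel₀ hL.ne' (hi (hm s) (hm t) hst))
  · ext z
    constructor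
    · rintro ⟨t, rfl⟩
      exact ⟨_, hm t, rfl⟩
    · rintro ⟨t, ht, rfl⟩
      refine ⟨⟨t / L, div_nonneg ht.1 hL.le, (div_le_one hL).2 ht.2⟩, ?_⟩
      simp only
      rw [mul_div_cancel₀ _ hL.ne']

theorem IsGeodesic.isArc {φ : ℝ → T} {x y : T} (h : IsGeodesic φ x y) (hxy : x ≠ y) :
    IsArc (φ '' Icc 0 (dist x y)) x y := by
  have := isArc_image (dist_pos.2 hxy) h.continuous h.injOn
  rwa [h.left, h.right] at this

theorem IsRTree.exists_geodesic (hT : IsRTree T) (x y : T) : ∃ φ, IsGeodesic φ x y := by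
  rcases eq_or_ne x y with rfl | hxy
  · refine ⟨fun _ => x, continuous_const, rfl, rfl, ?_⟩
    intro s hs t ht
    rw [dist_self, Icc_self] at hs ht
    rw [mem_singleton_iff.1 hs, mem_singleton_iff.1 ht]
    simp
  obtain ⟨A, hA, -⟩ := hT.existsUnique_arc x y hxy
  obtain ⟨a, b, hab, ⟨i⟩⟩ := hT.arc_isometric A x y hA
  set p : Icc a b := i ⟨x, hA.left_mem⟩ with hp
  set q : Icc a b := i ⟨y, hA.right_mem⟩ with hq
  have hd : |(p : ℝ) - q| = dist x y := by
    rw [← Real.dist_eq, ← Subtype.dist_eq, hp, hq, i.isometry.dist_eq, Subtype.dist_eq]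
  -- The isometry with an interval may reverse orientation; σ records the direction from p to q.
  obtain ⟨σ, hσ, hσq⟩ : ∃ σ : ℝ, |σ| = 1 ∧ (q : ℝ) = p + σ * dist x y := by
    rcases le_total (p : ℝ) q with h | h
    · refine ⟨1, by simp, ?_⟩
      rw [← hd, abs_of_nonpos (by linarith)]
      ring
    · refine ⟨-1, by simp, ?_⟩
      rw [← hd, abs_of_nonneg (by linarith)]
      ring
  have hmem : ∀ t ∈ Icc 0 (dist x y), (p : ℝ) + σ * t ∈ Icc a b := by
    intro t ht
    have hp' := p.2
    have hq' := q.2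
    rw [hσq] at hq'
    rcases (abs_eq zero_le_one).1 hσ with rfl | rfl
    · exact ⟨by linarith [hp'.1, ht.1], by linarith [hq'.2, ht.2]⟩
    · exact ⟨by linarith [hq'.1, ht.2], by linarith [hp'.2, ht.1]⟩
  -- `projIcc` extends the parametrization continuously to all of ℝ.
  refine ⟨fun t => (i.symm (projIcc a b hab ((p : ℝ) + σ * t)) : T), ?_, ?_, ?_, ?_⟩
  · have := i.symm.continuous
    have := continuous_projIcc (h := hab)
    fun_prop
  · simp [hp]
  · simp only [← hσq]
    simp [hq]
  · intro s hs t ht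
    rw [← Subtype.dist_eq, i.symm.isometry.dist_eq, projIcc_of_mem hab (hmem s hs),
      projIcc_of_mem hab (hmem t ht), Subtype.dist_eq, Real.dist_eq,
      show (p : ℝ) + σ * s - (p + σ * t) = σ * (s - t) by ring, abs_mul, hσ, one_mul]

/-- If two segments meet only in their common endpoint, then this point is on the arc joining the
other endpoints. -/
theorem IsRTree.mem_arc_of_inter (hT : IsRTree T) {x p y : T} (h : seg x p ∩ seg p y ⊆ {p})
    {A : Set T} (hA : IsArc A x y) : p ∈ A := by
  rcases eq_or_ne x p with rfl | hxp
  · exact hA.left_mem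
  rcases eq_or_ne p y with rfl | hpy
  · exact hA.right_mem
  obtain ⟨φ, hφ⟩ := hT.exists_geodesic x p
  obtain ⟨χ, hχ⟩ := hT.exists_geodesic p y
  have hd1 := dist_pos.2 hxp
  have hd2 := dist_pos.2 hpy
  -- The concatenation of the two geodesics is injective by `h`, so its image is the unique arc from
  -- x to y.
  let ψ : ℝ → T := fun t => if t ≤ dist x p then φ t else χ (t - dist x p)
  have hψc : Continuous ψ := by
    refine Continuous.if_le hφ.continuous (hχ.continuous.comp (by fun_prop)) continuous_id
      continuous_const ?_
    rintro t rfl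
    simp only [sub_self]
    rw [hφ.right, hχ.left]
  have hmix : ∀ s t, 0 ≤ s → s ≤ dist x p → dist x p < t → t ≤ dist x p + dist p y →
      φ s ≠ χ (t - dist x p) := by
    intro s t hs0 hs1 ht0 ht1 he
    have ht : t - dist x p ∈ Icc 0 (dist p y) := ⟨by linarith, by linarith⟩
    have hm : χ (t - dist x p) = p := h ⟨he ▸ hφ.mem_seg ⟨hs0, hs1⟩, hχ.mem_seg ht⟩
    have := hχ.dist_left ht
    rw [hm, dist_self] at this
    linarith
  have hψi : InjOn ψ (Icc 0 (dist x p + dist p y)) := by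
    intro s hs t ht hst
    simp only [ψ] at hst
    split_ifs at hst with h1 h2 h2
    · exact hφ.injOn ⟨hs.1, h1⟩ ⟨ht.1, h2⟩ hst
    · exact absurd hst (hmix s t hs.1 h1 (not_le.1 h2) ht.2)
    · exact absurd hst.symm (hmix t s ht.1 h2 (not_le.1 h1) hs.2)
    · have := hχ.injOn (x₁ := s - dist x p) ⟨by linarith, by linarith [hs.2]⟩
        (x₂ := t - dist x p) ⟨by linarith, by linarith [ht.2]⟩ hst
      linarith
  have hB := isArc_image (by linarith) hψc hψi
  have h0 : ψ 0 = x := by simp only [ψ, if_pos hd1.le, hφ.left]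
  have h1 : ψ (dist x p + dist p y) = y := by
    simp only [ψ]
    rw [if_neg (by linarith), add_sub_cancel_left, hχ.right]
  rw [h0, h1] at hB
  rw [(hT.existsUnique_arc x y hA.ne).unique hA hB]
  exact ⟨dist x p, ⟨hd1.le, by linarith⟩, by simp only [ψ, le_refl, if_true, hφ.right]⟩

/-- Metric betweenness already determines the arc: a point z with equality in the triangle
inequality splits the segment into halves meeting only in z, so uniqueness of arcs puts z on the
geodesic. -/
theorem IsRTree.image_geodesic (hT : IsRTree T) {φ : ℝ → T} {x y : T} (h : IsGeodesic φ x y) :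
    φ '' Icc 0 (dist x y) = seg x y := by
  refine Subset.antisymm ?_ ?_
  · rintro _ ⟨t, ht, rfl⟩
    exact h.mem_seg ht
  · intro z hz
    rcases eq_or_ne x y with rfl | hxy
    · rw [mem_seg, dist_self, dist_comm z x] at hz
      have : x = z := dist_le_zero.1 (by linarith [dist_nonneg (x := x) (y := z)])
      exact ⟨0, ⟨le_rfl, dist_nonneg⟩, h.left.trans this⟩
    · exact hT.mem_arc_of_inter (seg_inter_subset_of_mem hz) (h.isArc hxy)

theorem IsRTree.eq_seg_of_isArc (hT : IsRTree T) {A : Set T} {x y : T} (h : IsArc A x y) :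
    A = seg x y := by
  obtain ⟨φ, hφ⟩ := hT.exists_geodesic x y
  rw [← hT.image_geodesic hφ]
  exact (hT.existsUnique_arc x y h.ne).unique h (hφ.isArc h.ne)

theorem IsRTree.isArc_seg (hT : IsRTree T) {x y : T} (h : x ≠ y) : IsArc (seg x y) x y := by
  obtain ⟨A, hA, -⟩ := hT.existsUnique_arc x y h
  rwa [← hT.eq_seg_of_isArc hA]

theorem IsRTree.exists_eq_geodesic (hT : IsRTree T) {φ : ℝ → T} {x y z : T}
    (h : IsGeodesic φ x y) (hz : z ∈ seg x y) : φ (dist x z) = z := by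
  rw [← hT.image_geodesic h] at hz
  obtain ⟨t, ht, rfl⟩ := hz
  rw [h.dist_left ht]

theorem IsRTree.isCompact_seg (hT : IsRTree T) (x y : T) : IsCompact (seg x y) := by
  obtain ⟨φ, hφ⟩ := hT.exists_geodesic x y
  rw [← hT.image_geodesic hφ]
  exact isCompact_Icc.image hφ.continuous

theorem IsRTree.isPreconnected_seg (hT : IsRTree T) (x y : T) : IsPreconnected (seg x y) := by
  obtain ⟨φ, hφ⟩ := hT.exists_geodesic x y
  rw [← hT.image_geodesic hφ]
  exact isPreconnected_Icc.image _ hφ.continuous.continuousOn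

theorem IsRTree.dist_eq_abs (hT : IsRTree T) {x y z w : T} (hz : z ∈ seg x y) (hw : w ∈ seg x y) :
    dist z w = |dist x z - dist x w| := by
  obtain ⟨φ, hφ⟩ := hT.exists_geodesic x y
  have := hφ.dist_eq (dist x z) ⟨dist_nonneg, dist_le_of_mem_seg hz⟩ (dist x w)
    ⟨dist_nonneg, dist_le_of_mem_seg hw⟩
  rwa [hT.exists_eq_geodesic hφ hz, hT.exists_eq_geodesic hφ hw] at this

theorem IsRTree.mem_seg_of_dist_le (hT : IsRTree T) {x y z w : T} (hz : z ∈ seg x y)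
    (hw : w ∈ seg x y) (h : dist x z ≤ dist x w) : z ∈ seg x w := by
  rw [mem_seg, hT.dist_eq_abs hz hw, abs_of_nonpos (by linarith)]
  ring

theorem IsRTree.mem_seg_or (hT : IsRTree T) {x y z w : T} (hz : z ∈ seg x y)
    (hw : w ∈ seg x y) : z ∈ seg x w ∨ z ∈ seg w y := by
  rcases le_total (dist x z) (dist x w) with h | h
  · exact Or.inl (hT.mem_seg_of_dist_le hz hw h)
  · exact Or.inr (mem_seg_of_mem_seg_left hz (hT.mem_seg_of_dist_le hw hz h))

/-- Segments are convex. -/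
theorem IsRTree.seg_subset_seg (hT : IsRTree T) {x y z w : T} (hz : z ∈ seg x y)
    (hw : w ∈ seg x y) : seg z w ⊆ seg x y := by
  rcases hT.mem_seg_or hz hw with h | h
  · exact (seg_subset_right h).trans (seg_subset_left hw)
  · rw [seg_comm]
    exact (seg_subset_left h).trans (seg_subset_right hw)

/-- Any three points have a median. -/
theorem IsRTree.exists_median (hT : IsRTree T) (x y z : T) :
    ∃ p, p ∈ seg x y ∧ p ∈ seg x z ∧ p ∈ seg y z := by
  -- The median is the point of [x, y] nearest to z: the segment from p to z can meet [x, y] only in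
  -- p.
  obtain ⟨p, hp, hmin⟩ := (hT.isCompact_seg x y).exists_isMinOn ⟨x, left_mem_seg x y⟩
    (f := fun p => dist p z) (by fun_prop)
  have key : ∀ x', seg x' p ⊆ seg x y → p ∈ seg x' z := by
    intro x' hs
    have hi : seg x' p ∩ seg p z ⊆ {p} := by
      rintro w ⟨h1, h2⟩
      have := hmin (hs h1)
      simp only [mem_ofPred_eq] at this
      rw [mem_seg, dist_comm p w] at h2
      have h0 : dist w p ≤ 0 := by linarith
      exact dist_le_zero.1 h0
    rcases eq_or_ne x' z with rfl | hne
    · have := hi ⟨left_mem_seg _ _, right_mem_seg _ _⟩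
      rw [mem_singleton_iff] at this
      rw [← this]
      exact left_mem_seg _ _
    · exact hT.mem_arc_of_inter hi (hT.isArc_seg hne)
  exact ⟨p, hp, key x (seg_subset_left hp), key y (by rw [seg_comm]; exact seg_subset_right hp)⟩

/-- Triangles are tripods: the median of the three points lies on all three sides. -/
theorem IsRTree.seg_subset_union (hT : IsRTree T) (x w y : T) :
    seg x y ⊆ seg x w ∪ seg w y := by
  intro z hz
  obtain ⟨p, h1, h2, h3⟩ := hT.exists_median x y w
  rcases hT.mem_seg_or hz h1 with h | h
  · exact Or.inl (seg_subset_left h2 h)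
  · right
    rw [seg_comm] at h ⊢
    exact seg_subset_left h3 h

/-- A preconnected set contains the segment between any two of its points. -/
theorem IsRTree.seg_subset_of_isPreconnected (hT : IsRTree T) {C : Set T} (hC : IsPreconnected C)
    {x y : T} (hx : x ∈ C) (hy : y ∈ C) : seg x y ⊆ C := by
  intro z hz
  by_contra hzC
  -- If w' is closer to w than z is, then z is not on [w', w], so z separates x from w' whenever it
  -- separates x from w. Both sides of z are therefore open.
  have key : ∀ w w' : T, dist w' w < dist w z → z ∈ seg x w → z ∈ seg x w' := by
    intro w w' hd hw
    rcases hT.seg_subset_union x w' w hw with h | h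
    · exact h
    · rw [seg_comm] at h
      have := dist_le_of_mem_seg h
      rw [dist_comm w' w] at hd
      linarith
  have hU : IsOpen {w : T | w ≠ z ∧ z ∉ seg x w} := by
    refine Metric.isOpen_iff.2 fun w hw => ⟨dist w z, dist_pos.2 hw.1, fun w' hw' => ?_⟩
    rw [Metric.mem_ball] at hw'
    refine ⟨?_, fun h => ?_⟩
    · rintro rfl
      exact absurd (dist_comm w' w) hw'.ne
    · rcases hT.seg_subset_union x w w' h with h | h
      · exact hw.2 h
      · have := dist_le_of_mem_seg h
        rw [dist_comm w w'] at this
        linarith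
  have hW : IsOpen {w : T | w ≠ z ∧ z ∈ seg x w} := by
    refine Metric.isOpen_iff.2 fun w hw => ⟨dist w z, dist_pos.2 hw.1, fun w' hw' => ?_⟩
    rw [Metric.mem_ball] at hw'
    refine ⟨?_, key w w' hw' hw.2⟩
    rintro rfl
    exact absurd (dist_comm w' w) hw'.ne
  have hne : ∀ w ∈ C, w ≠ z := fun w hw h => hzC (h ▸ hw)
  obtain ⟨w, -, h1, h2⟩ := hC _ _ hU hW
    (fun w hw => by
      by_cases h : z ∈ seg x w
      · exact Or.inr ⟨hne w hw, h⟩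
      · exact Or.inl ⟨hne w hw, h⟩)
    ⟨x, hx, hne x hx, fun h => hne x hx (by
      rw [mem_seg, dist_self, dist_comm z x] at h
      exact dist_le_zero.1 (by linarith [dist_nonneg (x := x) (y := z)]))⟩
    ⟨y, hy, hne y hy, hz⟩
  exact h1.2 h2.2

/-- A point with at least three directions is not regular. -/
theorem IsRTree.mem_nonRegularPoints (hT : IsRTree T) {p u v w : T} (hu : u ≠ p) (hv : v ≠ p)
    (hw : w ≠ p) (huv : p ∈ seg u v) (huw : p ∈ seg u w) (hvw : p ∈ seg v w) :
    p ∈ nonRegularPoints T := by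
  intro hreg
  let c : ∀ x : T, x ≠ p → ConnectedComponents ↥({p}ᶜ : Set T) := fun x hx =>
    ((⟨x, hx⟩ : ↥({p}ᶜ : Set T)) : _)
  have key : ∀ (x y : T) (hx : x ≠ p) (hy : y ≠ p), p ∈ seg x y → c x hx ≠ c y hy := by
    intro x y hx hy hp h
    have h' := ConnectedComponents.coe_eq_coe.1 h
    have hpre := (isPreconnected_connectedComponent (x := (⟨x, hx⟩ : ↥({p}ᶜ : Set T)))).image
      Subtype.val continuous_subtype_val.continuousOn
    obtain ⟨q, -, hq⟩ := hT.seg_subset_of_isPreconnected hpre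
      ⟨_, mem_connectedComponent, rfl⟩ ⟨⟨y, hy⟩, h' ▸ mem_connectedComponent, rfl⟩ hp
    exact q.2 hq
  have hinj : Function.Injective ![c u hu, c v hv, c w hw] := by
    intro i j hij
    fin_cases i <;> fin_cases j <;> simp at hij ⊢
    · exact key u v hu hv huv hij
    · exact key u w hu hw huw hij
    · exact key u v hu hv huv hij.symm
    · exact key v w hv hw hvw hij
    · exact key u w hu hw huw hij.symm
    · exact key v w hv hw hvw hij.symm
  have h3 := ENat.card_le_card_of_injective hinj
  unfold IsRegularPoint at hreg
  rw [hreg] at h3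
  simp at h3
  exact absurd h3 (by decide)

end RTree

/-! ### Edges, vertices and midpoints -/

section Edges

variable {T : Type*} [MetricSpace T]

theorem IsDiscreteIn.isClosed {S : Set T} (hS : IsDiscreteIn S) : IsClosed S := by
  rw [← isOpen_compl_iff, Metric.isOpen_iff]
  intro p hp
  obtain ⟨ε, hε, h⟩ := hS p
  refine ⟨ε, hε, fun q hq hqS => ?_⟩
  have := h q hqS (by rintro rfl; exact hp hqS)
  rw [Metric.mem_ball, dist_comm] at hq
  linarith

theorem IsDiscreteIn.finite_inter {S K : Set T} (hS : IsDiscreteIn S) (hK : IsCompact K) :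
    (S ∩ K).Finite := by
  by_contra hinf
  obtain ⟨x, -, hx⟩ := Set.Infinite.exists_accPt_of_subset_isCompact hinf hK inter_subset_right
  obtain ⟨ε, hε, h⟩ := hS x
  obtain ⟨y, ⟨hy1, hy2⟩, hyx⟩ := accPt_iff_nhds.1 hx _ (Metric.ball_mem_nhds x hε)
  have := h y hy2.1 hyx
  rw [Metric.mem_ball, dist_comm] at hy1
  linarith

variable {V e e' : Set T} {u v x : T}

theorem IsEdgeBetween.ne (h : IsEdgeBetween V e u v) : u ≠ v := h.2.2.1.ne

theorem IsEdgeBetween.eq_seg (hT : IsRTree T) (h : IsEdgeBetween V e u v) : e = seg u v :=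
  hT.eq_seg_of_isArc h.2.2.1

theorem IsEdgeBetween.eq_or_eq (h : IsEdgeBetween V e u v) {w : T} (hwe : w ∈ e) (hwV : w ∈ V) :
    w = u ∨ w = v := by
  have : w ∈ e ∩ V := ⟨hwe, hwV⟩
  rw [h.2.2.2] at this
  simpa using this

/-- A point outside an edge is separated from it by one of its endpoints. -/
theorem IsEdgeBetween.mem_or (hT : IsRTree T) (hV : nonRegularPoints T ⊆ V)
    (h : IsEdgeBetween V e u v) (w : T) : w ∈ e ∨ u ∈ seg v w ∨ v ∈ seg u w := by
  -- A median different from u, v and w would be a branch point, hence a vertex inside the edge.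
  obtain ⟨p, h1, h2, h3⟩ := hT.exists_median u v w
  have he := h.eq_seg hT
  by_cases hu : u = p
  · exact Or.inr (Or.inl (hu ▸ h3))
  by_cases hv : v = p
  · exact Or.inr (Or.inr (hv ▸ h2))
  by_cases hw : w = p
  · exact Or.inl (by rw [hw, he]; exact h1)
  have hp := hV (hT.mem_nonRegularPoints hu hv hw h1 h2 h3)
  rcases h.eq_or_eq (he ▸ h1) hp with hp | hp
  · exact absurd hp.symm hu
  · exact absurd hp.symm hv

theorem IsEdgeBetween.left_mem_seg_or (hT : IsRTree T) (hV : nonRegularPoints T ⊆ V)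
    (h : IsEdgeBetween V e u v) (hx : x ∈ e) (z : T) :
    z ∈ e ∨ u ∈ seg x z ∨ v ∈ seg x z := by
  rw [h.eq_seg hT] at hx
  rcases h.mem_or hT hV z with hz | hz | hz
  · exact Or.inl hz
  · exact Or.inr (Or.inl (mem_seg_of_mem_seg_left hz (by rwa [seg_comm])))
  · exact Or.inr (Or.inr (mem_seg_of_mem_seg_left hz hx))

theorem IsRTree.left_eq_or_of_mem (hT : IsRTree T) {u v x z : T} (hx : x ∈ seg u v)
    (hz : z ∈ seg u v) (hu : u ∈ seg x z) : u = x ∨ u = z := by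
  rw [mem_seg, hT.dist_eq_abs hx hz, dist_comm x u] at hu
  have h1 := dist_nonneg (x := u) (y := x)
  have h2 := dist_nonneg (x := u) (y := z)
  rcases abs_cases (dist u x - dist u z) with h | h
  · right
    exact dist_le_zero.1 (by linarith)
  · left
    exact dist_le_zero.1 (by linarith)

/-- An edge consists of the points that can be reached from any of its interior points without
crossing a vertex. -/
theorem IsEdgeBetween.mem_iff (hT : IsRTree T) (hV : nonRegularPoints T ⊆ V)
    (h : IsEdgeBetween V e u v) (hx : x ∈ e) (hxV : x ∉ V) (z : T) :
    z ∈ e ↔ seg x z ∩ V ⊆ {z} := by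
  have he := h.eq_seg hT
  constructor
  · rintro hz w ⟨hw, hwV⟩
    have hwe : w ∈ e := by
      rw [he] at hx hz ⊢
      exact hT.seg_subset_seg hx hz hw
    rw [he] at hx hz
    rcases h.eq_or_eq hwe hwV with rfl | rfl
    · exact (hT.left_eq_or_of_mem hx hz hw).resolve_left fun h' => hxV (h' ▸ hwV)
    · rw [seg_comm] at hx hz
      exact (hT.left_eq_or_of_mem hx hz hw).resolve_left fun h' => hxV (h' ▸ hwV)
  · intro hz
    rcases h.left_mem_seg_or hT hV hx z with h1 | h1 | h1
    · exact h1
    · rw [← mem_singleton_iff.1 (hz ⟨h1, h.1⟩)]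
      exact h.2.2.1.left_mem
    · rw [← mem_singleton_iff.1 (hz ⟨h1, h.2.1⟩)]
      exact h.2.2.1.right_mem

/-- By `IsEdgeBetween.mem_iff` an edge is determined by any of its interior points, and the
criterion is unaffected by moving that point without crossing a vertex. -/
theorem edge_eq_edge (hT : IsRTree T) (hV : nonRegularPoints T ⊆ V) (he : e ∈ edgeSet V)
    (he' : e' ∈ edgeSet V) {x x' : T} (hx : x ∈ e) (hx' : x' ∈ e') (hxx' : seg x x' ∩ V = ∅) :
    e = e' := by
  have hxV : x ∉ V := fun h => (hxx' ▸ ⟨left_mem_seg x x', h⟩ : x ∈ (∅ : Set T))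
  have hxV' : x' ∉ V := fun h => (hxx' ▸ ⟨right_mem_seg x x', h⟩ : x' ∈ (∅ : Set T))
  obtain ⟨u, v, h⟩ := he
  obtain ⟨u', v', h'⟩ := he'
  have hn : ∀ w ∈ seg x x', w ∉ V := fun w hw hwV => (hxx' ▸ ⟨hw, hwV⟩ : w ∈ (∅ : Set T))
  ext z
  rw [h.mem_iff hT hV hx hxV, h'.mem_iff hT hV hx' hxV']
  constructor
  · rintro hz w ⟨hw, hwV⟩
    rcases hT.seg_subset_union x' x z hw with h1 | h1
    · rw [seg_comm] at h1
      exact absurd hwV (hn w h1)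
    · exact hz ⟨h1, hwV⟩
  · rintro hz w ⟨hw, hwV⟩
    rcases hT.seg_subset_union x x' z hw with h1 | h1
    · exact absurd hwV (hn w h1)
    · exact hz ⟨h1, hwV⟩

/-- A point off a closed set `V`, on a segment with endpoints in `V`, is on a `V`-edge contained in
this segment. -/
theorem exists_edge_of_mem_seg (hT : IsRTree T) (hV : IsClosed V) (hu : u ∈ V) (hv : v ∈ V)
    (hx : x ∈ seg u v) (hxV : x ∉ V) : ∃ e ∈ edgeSet V, x ∈ e ∧ e ⊆ seg u v := by
  -- Closedness of `V` provides the last vertex before x; used from both ends, this gives the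
  -- endpoints of the edge.
  have key : ∀ u ∈ V, ∃ u' ∈ V, u' ∈ seg u x ∧ seg u' x ∩ V ⊆ {u'} := by
    intro u hu
    obtain ⟨u', ⟨h1, h2⟩, hmin⟩ := ((hT.isCompact_seg u x).inter_right hV).exists_isMinOn
      ⟨u, left_mem_seg u x, hu⟩ (f := fun p => dist p x) (by fun_prop)
    refine ⟨u', h2, h1, ?_⟩
    rintro w ⟨hw, hwV⟩
    have := hmin ⟨seg_subset_right h1 hw, hwV⟩
    simp only [mem_ofPred_eq] at this
    rw [mem_seg] at hw
    exact (dist_le_zero.1 (by linarith : dist u' w ≤ 0)).symm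
  obtain ⟨u', huV, hu', hun⟩ := key u hu
  obtain ⟨v', hvV, hv', hvn⟩ := key v hv
  have hx1 : x ∈ seg u' v := mem_seg_of_mem_seg_left hx hu'
  have hx2 : x ∈ seg u' v' := by
    rw [seg_comm] at hx1 ⊢
    exact mem_seg_of_mem_seg_left hx1 hv'
  have hne : u' ≠ v' := by
    rintro rfl
    rw [mem_seg, dist_self, dist_comm x u'] at hx2
    exact hxV (dist_le_zero.1 (by linarith [dist_nonneg (x := u') (y := x)] : dist u' x ≤ 0) ▸ huV)
  refine ⟨seg u' v', ⟨u', v', huV, hvV, hT.isArc_seg hne, ?_⟩, hx2, ?_⟩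
  · refine Subset.antisymm ?_ ?_
    · rintro w ⟨hw, hwV⟩
      rcases hT.mem_seg_or hw hx2 with h | h
      · exact Or.inl (hun ⟨h, hwV⟩)
      · rw [seg_comm] at h
        exact Or.inr (hvn ⟨h, hwV⟩)
    · rintro w (rfl | rfl)
      · exact ⟨left_mem_seg _ _, huV⟩
      · exact ⟨right_mem_seg _ _, hvV⟩
  · refine hT.seg_subset_seg (seg_subset_left hx hu') ?_
    rw [seg_comm] at hx ⊢
    exact seg_subset_left hx hv'

/-- The convex hull of a set of vertices is a subtree. -/
theorem isSubtree_iUnion_seg (hT : IsRTree T) (hV : IsClosed V) {V' : Set T} (hV' : V' ⊆ V)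
    (hne : V'.Nonempty) : IsSubtree V {x | ∃ u ∈ V', ∃ v ∈ V', x ∈ seg u v} := by
  set A : Set T := {x | ∃ u ∈ V', ∃ v ∈ V', x ∈ seg u v} with hA
  refine ⟨⟨V ∩ A, inter_subset_left, {e | e ∈ edgeSet V ∧ e ⊆ A}, fun e he => he.1, ?_, ?_⟩, ?_, ?_⟩
  · rintro e ⟨-, he⟩ w ⟨hw, hwV⟩
    exact ⟨hwV, he hw⟩
  · refine Subset.antisymm ?_ ?_
    · intro x hx
      by_cases hxV : x ∈ V
      · exact Or.inl ⟨hxV, hx⟩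
      · obtain ⟨u, hu, v, hv, hxuv⟩ := hx
        obtain ⟨e, he, hxe, hes⟩ := exists_edge_of_mem_seg hT hV (hV' hu) (hV' hv) hxuv hxV
        exact Or.inr ⟨e, ⟨he, fun z hz => ⟨u, hu, v, hv, hes hz⟩⟩, hxe⟩
    · rintro x (hx | ⟨e, ⟨-, he⟩, hx⟩)
      · exact hx.2
      · exact he hx
  · obtain ⟨u, hu⟩ := hne
    exact ⟨u, u, hu, u, hu, left_mem_seg u u⟩
  · refine isPreconnected_of_forall_pair ?_
    rintro x ⟨u, hu, v, hv, hx⟩ y ⟨u', hu', v', hv', hy⟩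
    refine ⟨seg u v ∪ (seg v u' ∪ seg u' v'), ?_, Or.inl hx, Or.inr (Or.inr hy), ?_⟩
    · rintro z (hz | hz | hz)
      exacts [⟨u, hu, v, hv, hz⟩, ⟨v, hv, u', hu', hz⟩, ⟨u', hu', v', hv', hz⟩]
    · exact (hT.isPreconnected_seg u v).union v (right_mem_seg u v) (Or.inl (left_mem_seg v u'))
        ((hT.isPreconnected_seg v u').union u' (right_mem_seg v u') (left_mem_seg u' v')
          (hT.isPreconnected_seg u' v'))

/-- The set of midpoints of edges is discrete. -/
theorem isDiscreteIn_midpoints (hT : IsRTree T) (hV : nonRegularPoints T ⊆ V)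
    (hd : IsDiscreteIn V) :
    IsDiscreteIn {m | ∃ e u v, IsEdgeBetween V e u v ∧ m ∈ e ∧ dist m u = dist m v} := by
  set M : Set T := {m | ∃ e u v, IsEdgeBetween V e u v ∧ m ∈ e ∧ dist m u = dist m v} with hM
  -- Midpoints not separated by a vertex lie on the same edge, which has only one midpoint.
  have huniq : ∀ q ∈ M, ∀ q' ∈ M, seg q q' ∩ V = ∅ → q = q' := by
    rintro q ⟨e, u, v, h, hq, hm⟩ q' ⟨e', u', v', h', hq', hm'⟩ hqq'
    obtain rfl := edge_eq_edge hT hV ⟨u, v, h⟩ ⟨u', v', h'⟩ hq hq' hqq'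
    have hq'm : dist q' u = dist q' v := by
      rcases h.eq_or_eq h'.2.2.1.left_mem h'.1 with hu | hu <;>
      rcases h.eq_or_eq h'.2.2.1.right_mem h'.2.1 with hv | hv
      · exact absurd (hu.trans hv.symm) h'.ne
      · rw [← hu, ← hv, hm']
      · rw [← hu, ← hv, hm']
      · exact absurd (hu.trans hv.symm) h'.ne
    rw [h.eq_seg hT] at hq hq'
    have h1 := mem_seg.1 hq
    have h2 := mem_seg.1 hq'
    have h3 := hT.dist_eq_abs hq hq'
    rw [dist_comm u q] at h1 h3
    rw [dist_comm u q'] at h2 h3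
    rw [show dist q u - dist q' u = 0 by linarith, abs_zero] at h3
    exact dist_le_zero.1 h3.le
  intro p
  obtain ⟨ε, hε, hp⟩ := hd p
  by_cases hpV : p ∈ V
  -- The endpoints of an edge are equidistant from its midpoint q, and one of them lies on [q, p].
  -- If q is within ε / 4 of p, both are within ε / 2 of p, so both equal p.
  · refine ⟨ε / 4, by linarith, ?_⟩
    rintro q ⟨e, u, v, h, hq, hm⟩ -
    by_contra! hlt
    have hL : dist q u ≤ dist q p := by
      rcases h.left_mem_seg_or hT hV hq p with h1 | h1 | h1
      · rcases h.eq_or_eq h1 hpV with rfl | rfl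
        · exact le_rfl
        · exact hm.le
      · exact dist_le_of_mem_seg h1
      · rw [hm]
        exact dist_le_of_mem_seg h1
    have hnear : ∀ w ∈ V, dist q w = dist q u → w = p := by
      intro w hw hqw
      by_contra hne
      have := hp w hw hne
      have := dist_triangle p q w
      rw [dist_comm q p] at hL
      linarith
    exact h.ne ((hnear u h.1 rfl).trans (hnear v h.2.1 hm.symm).symm)
  · have hfree : ∀ q, dist p q < ε → seg p q ∩ V = ∅ := by
      intro q hq
      refine eq_empty_of_forall_notMem ?_
      rintro w ⟨hw, hwV⟩
      have := hp w hwV (by rintro rfl; exact hpV hwV)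
      have := dist_le_of_mem_seg hw
      linarith
    have huniq' : ∀ q ∈ M, ∀ q' ∈ M, dist p q < ε → dist p q' < ε → q = q' := by
      intro q hq q' hq' h1 h2
      refine huniq q hq q' hq' (eq_empty_of_forall_notMem ?_)
      rintro w ⟨hw, hwV⟩
      rcases hT.seg_subset_union q p q' hw with h | h
      · rw [seg_comm] at h
        exact (hfree q h1 ▸ ⟨h, hwV⟩ : w ∈ (∅ : Set T))
      · exact (hfree q' h2 ▸ ⟨h, hwV⟩ : w ∈ (∅ : Set T))
    by_cases hex : ∃ q ∈ M, q ≠ p ∧ dist p q < ε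
    · obtain ⟨q, hqM, hqp, hq⟩ := hex
      refine ⟨dist p q, dist_pos.2 hqp.symm, fun q' hq' hq'p => ?_⟩
      by_contra! hlt
      rw [huniq' q hqM q' hq' hq (hlt.trans hq)] at hlt
      exact lt_irrefl _ hlt
    · push Not at hex
      exact ⟨ε, hε, hex⟩

theorem IsDiscreteIn.mono {S S' : Set T} (h : IsDiscreteIn S') (hs : S ⊆ S') : IsDiscreteIn S := by
  intro p
  obtain ⟨ε, hε, hp⟩ := h p
  exact ⟨ε, hε, fun q hq => hp q (hs hq)⟩

theorem IsDiscreteIn.union {S S' : Set T} (h : IsDiscreteIn S) (h' : IsDiscreteIn S') :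
    IsDiscreteIn (S ∪ S') := by
  intro p
  obtain ⟨ε, hε, hp⟩ := h p
  obtain ⟨ε', hε', hp'⟩ := h' p
  refine ⟨min ε ε', lt_min hε hε', ?_⟩
  rintro q (hq | hq) hne
  · exact (min_le_left _ _).trans (hp q hq hne)
  · exact (min_le_right _ _).trans (hp' q hq hne)

end Edges

/-! ### Invariance of the vertex set and minimality -/

section Actions

/-- A set that every group element maps into itself is invariant. -/
theorem smul_eq_of_forall_mem {G X : Type*} [Group G] [MulAction G X] {S : Set X}
    (h : ∀ g : G, ∀ x ∈ S, g • x ∈ S) (g : G) : g • S = S := by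
  refine Subset.antisymm ?_ fun x hx => ?_
  · rintro _ ⟨x, hx, rfl⟩
    exact h g x hx
  · rw [mem_smul_set_iff_inv_smul_mem]
    exact h _ x hx

variable {G : Type*} [Group G] {T : Type*} [MetricSpace T] [MulAction G T] {V : Set T}

theorem IsVertexSet.nonRegularPoints_subset (h : IsVertexSet G V) : nonRegularPoints T ⊆ V := by
  intro x hx
  rw [h.eq_of_nonRegular ⟨x, hx⟩]
  exact Or.inl hx

theorem IsVertexSet.nonempty (h : IsVertexSet G V) : V.Nonempty := by
  rcases (nonRegularPoints T).eq_empty_or_nonempty with h0 | ⟨x, hx⟩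
  · exact (h.of_line h0).1
  · exact ⟨x, h.nonRegularPoints_subset hx⟩

theorem IsVertexSet.isDiscreteIn (h : IsVertexSet G V) (hT : IsMetricSimplicialTree T) :
    IsDiscreteIn V := by
  rcases (nonRegularPoints T).eq_empty_or_nonempty with h0 | h0
  · exact (h.of_line h0).2.1
  · rw [h.eq_of_nonRegular h0]
    refine hT.discrete.union
      ((isDiscreteIn_midpoints hT.isRTree subset_rfl hT.discrete).mono ?_)
    rintro m ⟨e, u, v, g, he, -, -, hm, hd⟩
    exact ⟨e, u, v, he, hm, hd⟩

variable [IsIsometricSMul G T]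

theorem smul_mem_seg_iff (g : G) {x y z : T} : g • z ∈ seg (g • x) (g • y) ↔ z ∈ seg x y := by
  simp [mem_seg]

theorem IsArc.smul {A : Set T} {x y : T} (h : IsArc A x y) (g : G) :
    IsArc (g • A) (g • x) (g • y) := by
  obtain ⟨γ, hc, hi, rfl, rfl, rfl⟩ := h
  refine ⟨fun t => g • γ t, (isometry_smul T g).continuous.comp hc,
    (MulAction.injective g).comp hi, rfl, rfl, ?_⟩
  rw [← image_smul, ← range_comp]
  rfl

theorem IsRegularPoint.smul {p : T} (h : IsRegularPoint p) (g : G) : IsRegularPoint (g • p) := by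
  let i : ↥({p}ᶜ : Set T) ≃ₜ ↥({g • p}ᶜ : Set T) :=
    (IsometryEquiv.constSMul g : T ≃ᵢ T).toHomeomorph.subtype fun x => by simp
  let j : ConnectedComponents ↥({p}ᶜ : Set T) ≃ ConnectedComponents ↥({g • p}ᶜ : Set T) :=
    { toFun := i.continuous.connectedComponentsMap
      invFun := i.symm.continuous.connectedComponentsMap
      left_inv := fun c => by
        obtain ⟨c, rfl⟩ := ConnectedComponents.surjective_coe c
        rw [Continuous.connectedComponentsMap_mk, Continuous.connectedComponentsMap_mk,
          i.symm_apply_apply]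
      right_inv := fun c => by
        obtain ⟨c, rfl⟩ := ConnectedComponents.surjective_coe c
        rw [Continuous.connectedComponentsMap_mk, Continuous.connectedComponentsMap_mk,
          i.apply_symm_apply] }
  exact (ENat.card_congr j).symm.trans h

theorem smul_nonRegularPoints (g : G) : g • nonRegularPoints T = nonRegularPoints T := by
  refine smul_eq_of_forall_mem ?_ g
  intro g x hx hreg
  refine hx ?_
  have := hreg.smul g⁻¹
  rwa [inv_smul_smul] at this

theorem IsEdgeBetween.smul {e : Set T} {u v : T} (h : IsEdgeBetween V e u v) {g : G}
    (hg : g • V = V) : IsEdgeBetween V (g • e) (g • u) (g • v) := by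
  refine ⟨hg ▸ smul_mem_smul_set h.1, hg ▸ smul_mem_smul_set h.2.1, h.2.2.1.smul g, ?_⟩
  nth_rewrite 1 [← hg]
  rw [← smul_set_inter, h.2.2.2, ← image_smul, image_pair]

theorem smul_invertedMidpoints (g : G) :
    g • (invertedMidpoints G : Set T) = invertedMidpoints G := by
  refine smul_eq_of_forall_mem ?_ g
  rintro h m ⟨e, u, v, g, he, hu, hv, hm, hd⟩
  refine ⟨h • e, h • u, h • v, h * g * h⁻¹, he.smul (smul_nonRegularPoints h), ?_, ?_,
    smul_mem_smul_set hm, ?_⟩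
  · rw [mul_smul, inv_smul_smul, mul_smul, hu]
  · rw [mul_smul, inv_smul_smul, mul_smul, hv]
  · rw [dist_smul, dist_smul, hd]

theorem IsVertexSet.smul_eq (h : IsVertexSet G V) (g : G) : g • V = V := by
  rcases (nonRegularPoints T).eq_empty_or_nonempty with h0 | h0
  · exact (h.of_line h0).2.2.1 g
  · rw [h.eq_of_nonRegular h0, smul_set_union, smul_nonRegularPoints, smul_invertedMidpoints]

/-- In a minimal tree every point is between two vertices of any given non-empty invariant set of
vertices. -/
theorem IsMinimalAction.exists_mem_seg (hmin : IsMinimalAction G V) (hT : IsRTree T)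
    (hV : IsClosed V) {V' : Set T} (hV' : V' ⊆ V) (hne : V'.Nonempty)
    (hinv : ∀ g : G, ∀ v ∈ V', g • v ∈ V') (x : T) : ∃ u ∈ V', ∃ v ∈ V', x ∈ seg u v := by
  have := hmin _ (isSubtree_iUnion_seg hT hV hV' hne) (smul_eq_of_forall_mem ?_)
  · exact (this ▸ mem_univ x : x ∈ {x | ∃ u ∈ V', ∃ v ∈ V', x ∈ seg u v})
  · rintro g x ⟨u, hu, v, hv, hx⟩
    exact ⟨g • u, hinv g u hu, g • v, hinv g v hv, (smul_mem_seg_iff g).2 hx⟩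

end Actions

/-! ### The orbit distance and compactness of the quotient -/

section OrbitDistance

variable (G : Type*) [Group G] {T : Type*} [MetricSpace T] [MulAction G T]

/-- The distance between the orbits of two points. -/
noncomputable def orbitDist (x y : T) : ℝ := ⨅ g : G, dist x (g • y)

variable {G}

theorem orbitDist_le (g : G) (x y : T) : orbitDist G x y ≤ dist x (g • y) :=
  ciInf_le ⟨0, by rintro _ ⟨g, rfl⟩; exact dist_nonneg⟩ g

theorem orbitDist_le_dist (x y : T) : orbitDist G x y ≤ dist x y := by
  simpa using orbitDist_le (1 : G) x y

theorem exists_dist_lt_of_orbitDist_lt {x y : T} {c : ℝ} (h : orbitDist G x y < c) :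
    ∃ g : G, dist x (g • y) < c :=
  exists_lt_of_ciInf_lt h

variable [IsIsometricSMul G T]

theorem orbitDist_comm (x y : T) : orbitDist G x y = orbitDist G y x := by
  have key : ∀ x y : T, orbitDist G x y ≤ orbitDist G y x := by
    intro x y
    refine le_ciInf fun g => (orbitDist_le g⁻¹ x y).trans_eq ?_
    rw [← dist_smul g, smul_inv_smul, dist_comm]
  exact le_antisymm (key x y) (key y x)

theorem orbitDist_triangle (x y z : T) :
    orbitDist G x z ≤ orbitDist G x y + orbitDist G y z := by
  refine le_of_forall_pos_le_add fun ε hε => ?_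
  obtain ⟨g, hg⟩ := exists_dist_lt_of_orbitDist_lt
    (lt_add_of_pos_right (orbitDist G x y) (half_pos hε))
  obtain ⟨h, hh⟩ := exists_dist_lt_of_orbitDist_lt
    (lt_add_of_pos_right (orbitDist G y z) (half_pos hε))
  have h1 := orbitDist_le (g * h) x z
  have h2 := dist_triangle x (g • y) ((g * h) • z)
  rw [mul_smul, dist_smul] at h2
  rw [mul_smul] at h1
  linarith

/-- If the quotient is compact, then it is totally bounded with respect to the orbit distance. -/
theorem IsCocompact.exists_finite (hc : IsCocompact G T) {ε : ℝ} (hε : 0 < ε) :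
    ∃ s : Set T, s.Finite ∧ ∀ y, ∃ x ∈ s, orbitDist G x y < ε := by
  have : CompactSpace (Quotient (MulAction.orbitRel G T)) := hc
  let q : T → Quotient (MulAction.orbitRel G T) := Quotient.mk _
  have hq : IsOpenMap q := isOpenMap_quotient_mk'_mul
  obtain ⟨t, ht⟩ := CompactSpace.elim_nhds_subcover (fun c => q '' Metric.ball c.out ε) (fun c =>
    (hq _ Metric.isOpen_ball).mem_nhds ⟨c.out, Metric.mem_ball_self hε, Quotient.out_eq c⟩)
  refine ⟨Quotient.out '' (t : Set (Quotient (MulAction.orbitRel G T))),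
    t.finite_toSet.image _, fun y => ?_⟩
  have hy : q y ∈ ⋃ c ∈ t, q '' Metric.ball c.out ε := ht ▸ mem_univ _
  simp only [mem_iUnion] at hy
  obtain ⟨c, hct, z, hz, hzy⟩ := hy
  refine ⟨c.out, ⟨c, hct, rfl⟩, ?_⟩
  obtain ⟨g, rfl⟩ := MulAction.orbitRel_apply.1 (Quotient.exact hzy)
  rw [Metric.mem_ball, dist_comm] at hz
  exact (orbitDist_le g _ _).trans_lt hz

/-- Pigeonhole on pairs of centres of a finite net, so that both sequences recur at the same two
times. -/
theorem IsCocompact.exists_recurrence (hc : IsCocompact G T) {ε : ℝ} (hε : 0 < ε)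
    (X Y : ℕ → T) :
    ∃ m n, m < n ∧ orbitDist G (X m) (X n) < ε ∧ orbitDist G (Y m) (Y n) < ε := by
  obtain ⟨s, hs, hcov⟩ := hc.exists_finite (half_pos hε)
  have := hs.to_subtype
  choose κ hκs hκ using hcov
  have hclose : ∀ x y, κ x = κ y → orbitDist G x y < ε := by
    intro x y hxy
    have h1 := hκ x
    have h2 := hκ y
    have h3 := orbitDist_triangle (G := G) x (κ x) y
    rw [orbitDist_comm x (κ x)] at h3
    rw [← hxy] at h2
    linarith
  obtain ⟨m, n, hmn, he⟩ := Finite.exists_ne_map_eq_of_infinite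
    (fun n => ((⟨κ (X n), hκs _⟩, ⟨κ (Y n), hκs _⟩) : s × s))
  simp only [Prod.mk.injEq, Subtype.mk.injEq] at he
  rcases lt_or_gt_of_ne hmn with h | h
  · exact ⟨m, n, h, hclose _ _ he.1, hclose _ _ he.2⟩
  · exact ⟨n, m, h, hclose _ _ he.1.symm, hclose _ _ he.2.symm⟩

/-- A surjective map that does not increase the distance between orbits preserves it if the quotient
is compact. -/
theorem IsCocompact.orbitDist_le_map (hc : IsCocompact G T) {f : T → T}
    (hs : Function.Surjective f)
    (hf : ∀ x y, orbitDist G (f x) (f y) ≤ orbitDist G x y) (a b : T) :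
    orbitDist G a b ≤ orbitDist G (f a) (f b) := by
  obtain ⟨s, hs⟩ := hs.hasRightInverse
  -- A backward orbit of f, indexed so that time 0 is f a and time 1 is a.
  let X : T → ℕ → T := fun a n => Nat.casesOn n (f a) fun k => s^[k] a
  have hX : ∀ a n, f (X a (n + 1)) = X a n := by
    rintro a (_ | k)
    · rfl
    · simp only [X, Function.iterate_succ_apply', hs (s^[k] a)]
  -- Applying f m times moves times m and m + k back to 0 and k, so a recurrence anywhere gives one
  -- at time 0.
  have hpush : ∀ a k m, orbitDist G (X a 0) (X a k) ≤ orbitDist G (X a m) (X a (m + k)) := by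
    intro a k m
    induction m with
    | zero => rw [Nat.zero_add]
    | succ m ih =>
      refine ih.trans ?_
      rw [Nat.succ_add, ← hX a m, ← hX a (m + k)]
      exact hf _ _
  have hmono : Monotone fun n => orbitDist G (X a n) (X b n) := by
    refine monotone_nat_of_le_succ fun n => ?_
    rw [← hX a n, ← hX b n]
    exact hf _ _
  refine le_of_forall_pos_le_add fun ε hε => ?_
  obtain ⟨m, n, hmn, h1, h2⟩ := hc.exists_recurrence (half_pos hε) (X a) (X b)
  -- At time k + 1 ≥ 1 the orbits are at least as far apart as a and b, by `hmono`, yet each is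
  -- within ε / 2 of its time 0 value f a or f b.
  obtain ⟨k, rfl⟩ := Nat.exists_eq_add_of_lt hmn
  have h3 := (hpush a (k + 1) m).trans_lt h1
  have h4 := (hpush b (k + 1) m).trans_lt h2
  have h5 : orbitDist G a b ≤ _ := hmono (Nat.le_add_left 1 k)
  have h6 := orbitDist_triangle (G := G) (X a (k + 1)) (X a 0) (X b (k + 1))
  have h7 := orbitDist_triangle (G := G) (X a 0) (X b 0) (X b (k + 1))
  rw [orbitDist_comm] at h3
  change _ ≤ orbitDist G (X a 0) (X b 0) + ε
  simp only at h5
  linarith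

end OrbitDistance

/-! ### Local consequences of trivial edge stabilisers -/

namespace MemDeformationSpace

variable {G : Type*} [Group G] {𝒢 : Set (Subgroup G)} {T : Type*} [MetricSpace T] [MulAction G T]
  {V : Set T}

theorem isIsometricSMul (hT : MemDeformationSpace T 𝒢 V) : IsIsometricSMul G T :=
  ⟨fun g => Isometry.of_dist_eq (hT.isometric g)⟩

theorem isDiscreteIn (hT : MemDeformationSpace T 𝒢 V) : IsDiscreteIn V :=
  hT.vertexSet.isDiscreteIn hT.tree

theorem smul_mem (hT : MemDeformationSpace T 𝒢 V) (g : G) {v : T} (hv : v ∈ V) : g • v ∈ V := by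
  have := hT.isIsometricSMul
  rw [← hT.vertexSet.smul_eq g]
  exact smul_mem_smul_set hv

theorem exists_mem_seg (hT : MemDeformationSpace T 𝒢 V) {V' : Set T} (hV' : V' ⊆ V)
    (hne : V'.Nonempty) (hinv : ∀ g : G, ∀ v ∈ V', g • v ∈ V') (x : T) :
    ∃ u ∈ V', ∃ v ∈ V', x ∈ seg u v :=
  have := hT.isIsometricSMul
  hT.minimal.exists_mem_seg hT.tree.isRTree hT.isDiscreteIn.isClosed hV' hne hinv x

theorem exists_edge (hT : MemDeformationSpace T 𝒢 V) {x : T} (hx : x ∉ V) :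
    ∃ e ∈ edgeSet V, x ∈ e := by
  obtain ⟨u, hu, v, hv, hxuv⟩ := hT.exists_mem_seg subset_rfl hT.vertexSet.nonempty
    (fun g v hv => hT.smul_mem g hv) x
  obtain ⟨e, he, hxe, -⟩ :=
    exists_edge_of_mem_seg hT.tree.isRTree hT.isDiscreteIn.isClosed hu hv hxuv hx
  exact ⟨e, he, hxe⟩

/-- Only the identity moves a point without crossing a vertex. -/
theorem eq_one_of_seg_inter (hT : MemDeformationSpace T 𝒢 V) {x : T} {g : G}
    (h : seg x (g • x) ∩ V = ∅) : g = 1 := by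
  have := hT.isIsometricSMul
  have hx : x ∉ V := fun hx => (h ▸ ⟨left_mem_seg _ _, hx⟩ : x ∈ (∅ : Set T))
  obtain ⟨e, he, hxe⟩ := hT.exists_edge hx
  have he' : g • e ∈ edgeSet V := by
    obtain ⟨u, v, huv⟩ := he
    exact ⟨_, _, huv.smul (hT.vertexSet.smul_eq g)⟩
  have hg : g ∈ MulAction.stabilizer G e := MulAction.mem_stabilizer_iff.2
    (edge_eq_edge hT.tree.isRTree hT.vertexSet.nonRegularPoints_subset he he' hxe
      (smul_mem_smul_set hxe) h).symm
  rwa [hT.edgeFree e he, Subgroup.mem_bot] at hg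

theorem exists_seg_inter_eq_empty (hT : MemDeformationSpace T 𝒢 V) {x : T} (hx : x ∉ V) :
    ∃ r > 0, ∀ y, dist x y < r → seg x y ∩ V = ∅ := by
  obtain ⟨r, hr, h⟩ := hT.isDiscreteIn x
  refine ⟨r, hr, fun y hy => eq_empty_of_forall_notMem ?_⟩
  rintro w ⟨hw, hwV⟩
  have := h w hwV (by rintro rfl; exact hx hwV)
  have := dist_le_of_mem_seg hw
  linarith

/-- Away from the vertices, the distance is locally the distance between orbits. -/
theorem exists_dist_le_dist_smul (hT : MemDeformationSpace T 𝒢 V) {x : T} (hx : x ∉ V) :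
    ∃ r > 0, ∀ y, dist x y < r → ∀ g : G, dist x y ≤ dist x (g • y) := by
  obtain ⟨r, hr, h⟩ := hT.exists_seg_inter_eq_empty hx
  refine ⟨r, hr, fun y hy g => ?_⟩
  by_contra! hlt
  -- Both y and g y are near x, so the segment between them passes through no vertex.
  have hg : g = 1 := by
    refine hT.eq_one_of_seg_inter (x := y) (eq_empty_of_forall_notMem ?_)
    rintro w ⟨hw, hwV⟩
    rcases hT.tree.isRTree.seg_subset_union y x (g • y) hw with h1 | h1
    · rw [seg_comm] at h1
      exact (h y hy ▸ ⟨h1, hwV⟩ : w ∈ (∅ : Set T))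
    · exact (h _ (hlt.trans hy) ▸ ⟨h1, hwV⟩ : w ∈ (∅ : Set T))
  rw [hg, one_smul] at hlt
  exact lt_irrefl _ hlt

/-- Any non-degenerate segment starts with a non-degenerate piece of an edge. -/
theorem exists_mem_seg_mem_edge (hT : MemDeformationSpace T 𝒢 V) {x y : T} (hxy : x ≠ y) :
    ∃ z ∈ seg x y, z ≠ x ∧ ∃ e ∈ edgeSet V, x ∈ e ∧ z ∈ e := by
  obtain ⟨ε, hε, h⟩ := hT.isDiscreteIn x
  obtain ⟨φ, hφ⟩ := hT.tree.isRTree.exists_geodesic x y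
  have hd := dist_pos.2 hxy
  -- The bound ε / 2 stops short of the next vertex, so z is not a vertex and its edge reaches back
  -- to x.
  have ht0 : 0 < min (ε / 2) (dist x y) := lt_min (half_pos hε) hd
  have htm : min (ε / 2) (dist x y) ∈ Icc 0 (dist x y) := ⟨ht0.le, min_le_right _ _⟩
  set z := φ (min (ε / 2) (dist x y)) with hz
  have hdz : dist x z = min (ε / 2) (dist x y) := hφ.dist_left htm
  have hzx : z ≠ x := by
    rintro h0
    rw [h0, dist_self] at hdz
    linarith
  have hfree : seg x z ∩ V ⊆ {x} := by
    rintro w ⟨hw, hwV⟩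
    by_contra hne
    have := h w hwV hne
    have := dist_le_of_mem_seg hw
    have := min_le_left (ε / 2) (dist x y)
    linarith
  have hzV : z ∉ V := fun hzV => hzx (hfree ⟨right_mem_seg _ _, hzV⟩)
  obtain ⟨e, he, hze⟩ := hT.exists_edge hzV
  refine ⟨z, hφ.mem_seg htm, hzx, e, he, ?_, hze⟩
  obtain ⟨u, v, huv⟩ := he
  rw [huv.mem_iff hT.tree.isRTree hT.vertexSet.nonRegularPoints_subset hze hzV, seg_comm]
  exact hfree

/-! ### Equivariant 1-Lipschitz maps -/

section Maps

variable {α : MulAut G} {f : T → T}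

/-- Equivariant maps between minimal trees are onto. -/
theorem surjective_of_equivariant [Nontrivial T] (hT : MemDeformationSpace T 𝒢 V)
    (hc : Continuous f) (heq : ∀ (g : G) (x : T), f (g • x) = α g • f x) :
    Function.Surjective f := by
  have := hT.isIsometricSMul
  have hTree := hT.tree.isRTree
  obtain ⟨v, hv⟩ := hT.vertexSet.nonempty
  have hpre : IsPreconnected (range f) := by
    rw [← image_univ]
    refine IsPreconnected.image ?_ f hc.continuousOn
    exact isPreconnected_of_forall_pair fun x _ y _ => ⟨seg x y, subset_univ _,
      left_mem_seg x y, right_mem_seg x y, hTree.isPreconnected_seg x y⟩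
  have hinv : ∀ (g : G), ∀ x ∈ range f, g • x ∈ range f := by
    rintro g _ ⟨x, rfl⟩
    exact ⟨α.symm g • x, by rw [heq, MulEquiv.apply_symm_apply]⟩
  -- If the connected invariant image missed all vertices, G would be trivial; then a single vertex
  -- would be an invariant subtree and T a point.
  have hne : (V ∩ range f).Nonempty := by
    by_contra hne
    rw [not_nonempty_iff_eq_empty] at hne
    have htriv : ∀ g : G, g = 1 := by
      intro g
      refine hT.eq_one_of_seg_inter (x := f v) (eq_empty_of_forall_notMem ?_)
      rintro w ⟨hw, hwV⟩
      have hwr := hTree.seg_subset_of_isPreconnected hpre ⟨v, rfl⟩ (hinv g _ ⟨v, rfl⟩) hw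
      exact (hne ▸ ⟨hwV, hwr⟩ : w ∈ (∅ : Set T))
    have hsing : ∀ x : T, x = v := by
      intro x
      obtain ⟨u, hu, w, hw, hx⟩ := hT.exists_mem_seg (singleton_subset_iff.2 hv)
        (singleton_nonempty v) (fun g w hw => by rw [htriv g, one_smul]; exact hw) x
      rw [mem_singleton_iff.1 hu, mem_singleton_iff.1 hw, mem_seg, dist_self] at hx
      exact dist_le_zero.1 (by linarith [dist_nonneg (x := v) (y := x), dist_comm x v])
    obtain ⟨x, y, hxy⟩ := exists_pair_ne T
    exact hxy ((hsing x).trans (hsing y).symm)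
  intro x
  obtain ⟨u, hu, w, hw, hx⟩ := hT.exists_mem_seg inter_subset_left hne
    (fun g u hu => ⟨hT.smul_mem g hu.1, hinv g u hu.2⟩) x
  exact hTree.seg_subset_of_isPreconnected hpre hu.2 hw.2 hx

variable [Nontrivial T] (hT : MemDeformationSpace T 𝒢 V) (hlip : LipschitzWith 1 f)
  (heq : ∀ (g : G) (x : T), f (g • x) = α g • f x)

include hT hlip heq

/-- Since f preserves the orbit distance, some translate of b is almost as close to a as f b is to f
a. The infimum need not be attained, hence the ε. -/
theorem exists_dist_smul_le (a b : T) {ε : ℝ} (hε : 0 < ε) :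
    ∃ g : G, dist a (g • b) < dist (f a) (f b) + ε := by
  have := hT.isIsometricSMul
  have hd : ∀ x y, dist (f x) (f y) ≤ dist x y := fun x y => by simpa using hlip.dist_le_mul x y
  refine exists_dist_lt_of_orbitDist_lt ?_
  have h1 := hT.cocompact.orbitDist_le_map (hT.surjective_of_equivariant hlip.continuous heq)
    (fun x y => le_ciInf fun g => (orbitDist_le (α g) _ _).trans (by
      rw [← heq]
      exact hd _ _)) a b
  have h2 := orbitDist_le_dist (G := G) (f a) (f b)
  linarith

/-- The map is injective away from the vertices. -/
theorem eq_of_map_eq {x y : T} (hx : x ∉ V) (hfx : f x ∉ V) (hxy : f x = f y) : x = y := by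
  obtain ⟨r, hr, h⟩ := hT.exists_dist_le_dist_smul hx
  obtain ⟨g, hg⟩ := hT.exists_dist_smul_le hlip heq x y hr
  rw [← hxy, dist_self, zero_add] at hg
  -- The orbit of y comes arbitrarily close to x, and g y is already the translate nearest to x.
  have hxg : x = g • y := by
    refine dist_le_zero.1 (le_of_forall_pos_lt_add fun ε hε => ?_)
    obtain ⟨k, hk⟩ := hT.exists_dist_smul_le hlip heq x y hε
    rw [← hxy, dist_self] at hk
    have := h _ hg (k * g⁻¹)
    rw [mul_smul, inv_smul_smul] at this
    exact this.trans_lt hk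
  -- The element α g fixes f x, which is not a vertex.
  have hα : α g = 1 := by
    refine hT.eq_one_of_seg_inter (x := f x) (eq_empty_of_forall_notMem ?_)
    have : α g • f x = f x := by rw [hxy, ← heq, ← hxg, hxy]
    rw [this]
    rintro w ⟨hw, hwV⟩
    rw [mem_seg, dist_self] at hw
    refine hfx ?_
    rwa [dist_le_zero.1 (by linarith [dist_nonneg (x := w) (y := f x), dist_comm w (f x)] :
      dist (f x) w ≤ 0)]
  rwa [(map_eq_one_iff α α.injective).1 hα, one_smul] at hxg

/-- The midpoint of an edge is not a vertex, so near it distances are orbit distances and f cannot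
shrink them. One short piece of unchanged length fixes the constant speed at 1. -/
theorem dist_map_of_mem_edge (hst : IsStraight V f) {e : Set T} (he : e ∈ edgeSet V) {a b : T}
    (ha : a ∈ e) (hb : b ∈ e) : dist (f a) (f b) = dist a b := by
  obtain ⟨l, -, hl⟩ := hst e he
  obtain ⟨u, v, huv⟩ := he
  have hTree := hT.tree.isRTree
  obtain ⟨φ, hφ⟩ := hTree.exists_geodesic u v
  have hd := dist_pos.2 huv.ne
  have hmem : ∀ t ∈ Icc 0 (dist u v), φ t ∈ e := fun t ht => by
    rw [huv.eq_seg hTree]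
    exact hφ.mem_seg ht
  have hm : dist u v / 2 ∈ Icc 0 (dist u v) := ⟨by linarith, by linarith⟩
  have hmV : φ (dist u v / 2) ∉ V := by
    intro hV
    have h1 := hφ.dist_left hm
    have h2 := hφ.dist_right hm
    rcases huv.eq_or_eq (hmem _ hm) hV with h | h
    · rw [h, dist_self] at h1
      linarith
    · rw [h, dist_self] at h2
      linarith
  obtain ⟨r, hr, h⟩ := hT.exists_dist_le_dist_smul hmV
  -- The first bound keeps the second point where distance is orbit distance, the second keeps it on
  -- the edge.
  have hδ : 0 < min (r / 2) (dist u v / 2) := lt_min (half_pos hr) (half_pos hd)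
  have hδ1 := min_le_left (r / 2) (dist u v / 2)
  have hδ2 := min_le_right (r / 2) (dist u v / 2)
  have hn : dist u v / 2 + min (r / 2) (dist u v / 2) ∈ Icc 0 (dist u v) :=
    ⟨by linarith, by linarith⟩
  have hdist := hφ.dist_eq _ hm _ hn
  rw [sub_add_cancel_left, abs_neg, abs_of_pos hδ] at hdist
  have hle : dist (φ (dist u v / 2)) (φ (dist u v / 2 + min (r / 2) (dist u v / 2))) ≤
      dist (f (φ (dist u v / 2))) (f (φ (dist u v / 2 + min (r / 2) (dist u v / 2)))) := by
    refine le_of_forall_pos_le_add fun ε hε => ?_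
    obtain ⟨g, hg⟩ := hT.exists_dist_smul_le hlip heq (φ (dist u v / 2))
      (φ (dist u v / 2 + min (r / 2) (dist u v / 2))) hε
    exact (h _ (by linarith) g).trans hg.le
  have hge := hlip.dist_le_mul (φ (dist u v / 2))
    (φ (dist u v / 2 + min (r / 2) (dist u v / 2)))
  rw [NNReal.coe_one, one_mul] at hge
  have hl1 := hl _ (hmem _ hm) _ (hmem _ hn)
  rw [le_antisymm hge hle, hdist] at hl1
  have : l = 1 := by
    field_simp at hl1
    exact hl1.symm
  rw [hl a ha b hb, this, one_mul]

/-- There is no folding: if the median p of the images differs from f b, then [p, f b] is covered by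
the images of both [a, b] and [b, c]. -/
theorem map_mem_seg {a b c : T} (hb : b ∈ seg a c) : f b ∈ seg (f a) (f c) := by
  have hTree := hT.tree.isRTree
  obtain ⟨p, h1, h2, h3⟩ := hTree.exists_median (f a) (f b) (f c)
  by_cases hp : p = f b
  · rwa [hp] at h2
  exfalso
  have hsub : ∀ x y, seg (f x) (f y) ⊆ f '' seg x y := fun x y =>
    hTree.seg_subset_of_isPreconnected
      ((hTree.isPreconnected_seg x y).image f hlip.continuous.continuousOn)
      ⟨x, left_mem_seg x y, rfl⟩ ⟨y, right_mem_seg x y, rfl⟩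
  have hinf : (seg p (f b)).Infinite := by
    obtain ⟨φ, hφ⟩ := hTree.exists_geodesic p (f b)
    rw [← hTree.image_geodesic hφ]
    exact (Icc_infinite (dist_pos.2 hp)).image hφ.injOn
  -- Off this finite set `eq_of_map_eq` applies: the preimages in [a, b] and [b, c] coincide, so
  -- they equal b, but f b was excluded too.
  have hfin : (V ∩ seg p (f b) ∪ (f '' (V ∩ seg a c) ∪ {f b})).Finite :=
    (hT.isDiscreteIn.finite_inter (hTree.isCompact_seg _ _)).union
      (((hT.isDiscreteIn.finite_inter (hTree.isCompact_seg _ _)).image f).union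
        (finite_singleton _))
  obtain ⟨w, hw, hw'⟩ := (hinf.sdiff hfin).nonempty
  have hwV : w ∉ V := fun h => hw' (Or.inl ⟨h, hw⟩)
  obtain ⟨a', ha', rfl⟩ := hsub a b (seg_subset_right h1 hw)
  obtain ⟨b', hb', hab⟩ := hsub b c (seg_subset_left h3 (by rwa [seg_comm]))
  have haV : a' ∉ V := fun h => hw' (Or.inr (Or.inl ⟨a', ⟨h, seg_subset_left hb ha'⟩, rfl⟩))
  have heq' := hT.eq_of_map_eq hlip heq haV hwV hab.symm
  have := seg_inter_subset_of_mem hb ⟨ha', heq' ▸ hb'⟩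
  exact hw' (Or.inr (Or.inr (congrArg f this)))

/-- A straight equivariant `1`-Lipschitz map from a tree to a twist of it is an isometry. -/
theorem isometry_of_lipschitzWith_one (hst : IsStraight V f) : Isometry f := by
  refine Isometry.of_dist_eq fun x y => ?_
  have hTree := hT.tree.isRTree
  obtain ⟨φ, hφ⟩ := hTree.exists_geodesic x y
  have hcl : IsClosed {t | dist (f x) (f (φ t)) = t} :=
    isClosed_eq (continuous_const.dist (hlip.continuous.comp hφ.continuous)) continuous_id
  -- At the last time t up to which length is preserved, the next piece of edge is mapped
  -- isometrically and, by betweenness, its length adds on, contradicting maximality.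
  obtain ⟨t, ⟨ht, htS⟩, hmax⟩ := (isCompact_Icc.inter_right hcl).exists_isGreatest
    ⟨0, ⟨le_rfl, dist_nonneg (x := x) (y := y)⟩, by simp [hφ.left]⟩
  rcases ht.2.eq_or_lt with rfl | hlt
  · rwa [mem_ofPred_eq, hφ.right] at htS
  exfalso
  have hty : φ t ≠ y := by
    intro h
    have := hφ.dist_left ht
    rw [h] at this
    linarith
  obtain ⟨z, hz, hzt, e, he, hte, hze⟩ := hT.exists_mem_seg_mem_edge hty
  have hd := hT.dist_map_of_mem_edge hlip heq hst he hte hze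
  have hm := hφ.mem_seg ht
  have htz : φ t ∈ seg x z := by
    rw [seg_comm] at hm hz ⊢
    exact mem_seg_of_mem_seg_left hm hz
  have hzxy := seg_subset_right hm hz
  have h1 := mem_seg.1 htz
  have h2 := mem_seg.1 (hT.map_mem_seg hlip heq htz)
  rw [hφ.dist_left ht] at h1
  rw [mem_ofPred_eq] at htS
  rw [htS, hd] at h2
  have := hmax ⟨⟨dist_nonneg, dist_le_of_mem_seg hzxy⟩, (by
    rw [mem_ofPred_eq, hTree.exists_eq_geodesic hφ hzxy]
    linarith : dist x z ∈ {t | dist (f x) (f (φ t)) = t})⟩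
  have := dist_pos.2 hzt.symm
  linarith

end Maps

end MemDeformationSpace

/-! ### The least Lipschitz constant -/

section Lip

variable {X Y : Type*} [MetricSpace X] [MetricSpace Y] {f : X → Y}

theorem lipschitzWith_lip (hf : ∃ K : ℝ≥0, LipschitzWith K f) : LipschitzWith (lip f) f := by
  refine LipschitzWith.of_dist_le_mul fun x y => ?_
  refine le_of_forall_pos_le_add fun ε hε => ?_
  have hd : 0 < dist x y + 1 := by linarith [dist_nonneg (x := x) (y := y)]
  -- The summand 1 in the denominator keeps it positive when x = y.
  obtain ⟨K, hK, hlt⟩ := exists_lt_of_csInf_lt (s := {K : ℝ≥0 | LipschitzWith K f}) hf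
    (lt_add_of_pos_right (lip f) (Real.toNNReal_pos.2 (div_pos hε hd)))
  have h1 : (K : ℝ) ≤ lip f + ε / (dist x y + 1) := by
    have := NNReal.coe_lt_coe.2 hlt
    rw [NNReal.coe_add, Real.coe_toNNReal _ (div_pos hε hd).le] at this
    exact this.le
  calc dist (f x) (f y) ≤ K * dist x y := hK.dist_le_mul x y
    _ ≤ (lip f + ε / (dist x y + 1)) * dist x y := by gcongr
    _ = lip f * dist x y + ε * (dist x y / (dist x y + 1)) := by ring
    _ ≤ lip f * dist x y + ε * 1 := by
      gcongr
      exact (div_le_one hd).2 (by linarith)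
    _ = _ := by rw [mul_one]

theorem lip_eq_one_of_isometry [Nontrivial X] (hf : Isometry f) : lip f = 1 := by
  refine le_antisymm (csInf_le (OrderBot.bddBelow _) hf.lipschitz)
    (le_csInf ⟨1, hf.lipschitz⟩ fun K hK => ?_)
  obtain ⟨x, y, hxy⟩ := exists_pair_ne X
  have := LipschitzWith.dist_le_mul hK x y
  rw [hf.dist_eq] at this
  exact_mod_cast (le_mul_iff_one_le_left (dist_pos.2 hxy)).1 this

end Lip

end OuterSpace

theorem mainTheorem6 {G : Type*} [Group G] (𝒢 : Set (Subgroup G))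
    {T : Type*} [MetricSpace T] [MulAction G T] [Nontrivial T] (V : Set T)
    (hT : OuterSpace.MemDeformationSpace T 𝒢 V)
    (α : MulAut G) (hα : OuterSpace.PreservesSystem α 𝒢)
    (f : T → OuterSpace.Twist α T) (hf : OuterSpace.TopologicallyRepresents V α f) :
    OuterSpace.lip f = 1 ↔ (Isometry f ∧ Function.Surjective f) := by
  obtain ⟨⟨heq, hK⟩, hst⟩ := hf
  constructor
  · intro h
    have hlip := OuterSpace.lipschitzWith_lip hK
    rw [h] at hlip
    -- `Twist α T` unfolds to T with g acting as α g, so `heq` is the twisted equivariance of a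
    -- self-map of T.
    exact ⟨hT.isometry_of_lipschitzWith_one (f := f) (α := α) hlip heq hst,
      hT.surjective_of_equivariant (f := f) (α := α) hlip.continuous heq⟩
  · exact fun h => OuterSpace.lip_eq_one_of_isometry h.1
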